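/- Let $X\in\mathbb{R}^{n\times p}$ have columns $X_1,\dots,X_p$, let $y\in\mathbb{R}^n$, and for $\lambda\in\mathbb{R}$ consider the Lasso problem of minimizing $\tfrac12\|y-X\beta\|_2^2+e^{\lambda}\|\beta\|_1$ over $\beta\in\mathbb{R}^p$. For a solution $\beta$ of the problem with parameter $\lambda$, let $\mathcal{E}=\{j: |X_j^T(y-X\beta)|=e^{\lambda}\}$ be its equicorrelation set (it does not depend on the choice of the solution $\beta$), let $\operatorname{supp}\beta=\{i:\beta_i\neq0\}$, and let $X_{\mathcal{E}}$ be the submatrix of $X$ formed by the columns indexed by $\mathcal{E}$. Assume that, for every $\lambda\in\mathbb{R}$, the matrix $X_{\mathcal{E}}^TX_{\mathcal{E}}$ is invertible. Then for every $\lambda\in\mathbb{R}$ the Lasso problem has exactly one solution $\hat\beta(\lambda)$, and the function $\hat\beta:\mathbb{R}\to\mathbb{R}^p$ is path differentiable. For $\lambda\in\mathbb{R}$ let $\mathcal{M}(\lambda)$ be the set of all $q\in\mathbb{R}^p$ with $q_i=1$ if $i\in\operatorname{supp}\hat\beta(\lambda)$, $q_i\in[0,1]$ if $i\in\mathcal{E}\setminus\operatorname{supp}\hat\beta(\lambda)$,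 and $q_i=0$ if $i\notin\mathcal{E}$. Then, for all $\lambda\in\mathbb{R}$ and $q\in\mathcal{M}(\lambda)$, the matrix $\mathrm{Id}_p-\operatorname{diag}(q)(\mathrm{Id}_p-X^TX)$ is invertible, and $$J_{\hat\beta}(\lambda)=\Big\{-e^{\lambda}\big(\mathrm{Id}_p-\operatorname{diag}(q)(\mathrm{Id}_p-X^TX)\big)^{-1}\operatorname{diag}(q)\,\operatorname{sign}\big(\hat\beta(\lambda)-X^T(X\hat\beta(\lambda)-y)\big): q\in\mathcal{M}(\lambda)\Big\}$$ (with $\operatorname{sign}$ taken componentwise) defines a conservative Jacobian for $\hat\beta$. Here a conservative Jacobian for a locally Lipschitz $f:\mathbb{R}^k\to\mathbb{R}^m$ is a set-valued map $J:\mathbb{R}^k\rightrightarrows\mathbb{R}^{m\times k}$ with nonempty values and closed graph that is locally bounded and satisfies, for every absolutely continuous curve $\gamma:\mathbb{R}\to\mathbb{R}^k$ and almost every $t$, $\frac{\mathrm{d}}{\mathrm{d}t}f(\gamma(t))=V\dot\gamma(t)$ for all $V\in J(\gamma(t))$; and $f$ is path differentiable if it is locally Lipschitz and has a conservative Jacobian.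 -/

import Mathlib

open Set Filter Topology MeasureTheory Matrix

/-- A continuous curve `γ : ℝ → E` (with `E` a finite-dimensional real normed space) is absolutely
continuous if it is differentiable at almost every time and is recovered by integrating its
(locally integrable) derivative. -/
structure IsAbsolutelyContinuousCurve {E : Type*} [NormedAddCommGroup E] [NormedSpace ℝ E]
    (γ : ℝ → E) : Prop where
  continuous : Continuous γ
  ae_differentiableAt : ∀ᵐ t : ℝ, DifferentiableAt ℝ γ t
  intervalIntegrable : ∀ t : ℝ, IntervalIntegrable (deriv γ) volume 0 t
  sub_eq_integral : ∀ t : ℝ, γ t - γ 0 = ∫ τ in (0 : ℝ)..t, deriv γ τ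

/-- The set-valued map `J` is a conservative Jacobian for `f`: it has nonempty values and a closed
graph, it is locally bounded, and along every absolutely continuous curve `γ`, for almost every
time `t`, the derivative of `f ∘ γ` at `t` exists and equals `V (γ' t)` for every
`V ∈ J (γ t)`. Jacobian matrices are represented as continuous linear maps. -/
structure IsConservativeJacobian {E F : Type*} [NormedAddCommGroup E] [NormedSpace ℝ E]
    [NormedAddCommGroup F] [NormedSpace ℝ F] (f : E → F) (J : E → Set (E →L[ℝ] F)) : Prop where
  nonempty : ∀ x, (J x).Nonempty
  isClosed_graph : IsClosed {z : E × (E →L[ℝ] F) | z.2 ∈ J z.1}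
  locally_bounded : ∀ x, ∃ U ∈ 𝓝 x, ∃ M : ℝ, 0 < M ∧ ∀ u ∈ U, ∀ V ∈ J u, ‖V‖ < M
  chain_rule : ∀ γ : ℝ → E, IsAbsolutelyContinuousCurve γ →
    ∀ᵐ t : ℝ, ∀ V ∈ J (γ t), HasDerivAt (fun s => f (γ s)) (V (deriv γ t)) t

/-- A function is path differentiable if it is locally Lipschitz and has a conservative
Jacobian. -/
def PathDifferentiable {E F : Type*} [NormedAddCommGroup E] [NormedSpace ℝ E]
    [NormedAddCommGroup F] [NormedSpace ℝ F] (f : E → F) : Prop :=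
  LocallyLipschitz f ∧ ∃ J : E → Set (E →L[ℝ] F), IsConservativeJacobian f J

namespace Lasso

variable {n p : ℕ}

/-- The residual `y - X β`. -/
def residual (X : Matrix (Fin n) (Fin p) ℝ) (y : EuclideanSpace ℝ (Fin n))
    (β : EuclideanSpace ℝ (Fin p)) : EuclideanSpace ℝ (Fin n) :=
  y - WithLp.toLp 2 (X *ᵥ β.ofLp)

/-- The Lasso objective `½ ‖y - X β‖₂² + e^lam ‖β‖₁`. -/
noncomputable def objective (X : Matrix (Fin n) (Fin p) ℝ) (y : EuclideanSpace ℝ (Fin n))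
    (lam : ℝ) (β : EuclideanSpace ℝ (Fin p)) : ℝ :=
  1 / 2 * ‖residual X y β‖ ^ 2 + Real.exp lam * ∑ i, |β i|

/-- The set of minimizers of the Lasso objective over `ℝᵖ`. -/
def solutions (X : Matrix (Fin n) (Fin p) ℝ) (y : EuclideanSpace ℝ (Fin n))
    (lam : ℝ) : Set (EuclideanSpace ℝ (Fin p)) :=
  {β | ∀ b, objective X y lam β ≤ objective X y lam b}

/-- The equicorrelation set `{j : |X_jᵀ (y - X β)| = e^lam}`. -/
noncomputable def equicorrelation (X : Matrix (Fin n) (Fin p) ℝ) (y : EuclideanSpace ℝ (Fin n))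
    (lam : ℝ) (β : EuclideanSpace ℝ (Fin p)) : Finset (Fin p) :=
  Finset.univ.filter fun j => |(Xᵀ *ᵥ (residual X y β).ofLp) j| = Real.exp lam

/-- The submatrix `X_E` of `X` made of the columns with index in `E`. -/
def columns (X : Matrix (Fin n) (Fin p) ℝ) (E : Finset (Fin p)) : Matrix (Fin n) E ℝ :=
  X.submatrix id (fun j : E => (j : Fin p))

/-- The set `M` of the vectors `q` with `q i = 1` on the support of `β`, `q i = 0` off the
equicorrelation set `E`, and `q i ∈ [0, 1]` for `i ∈ E` outside the support. -/
def multipliers (X : Matrix (Fin n) (Fin p) ℝ) (y : EuclideanSpace ℝ (Fin n))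
    (lam : ℝ) (β : EuclideanSpace ℝ (Fin p)) : Set (Fin p → ℝ) :=
  {q | (∀ i, β i ≠ 0 → q i = 1) ∧
    (∀ i, i ∉ equicorrelation X y lam β → q i = 0) ∧
    (∀ i, i ∈ equicorrelation X y lam β → β i = 0 → q i ∈ Icc (0 : ℝ) 1)}

/-- The matrix `Id - diag(q) (Id - Xᵀ X)`. -/
def systemMatrix (X : Matrix (Fin n) (Fin p) ℝ) (q : Fin p → ℝ) : Matrix (Fin p) (Fin p) ℝ :=
  1 - diagonal q * (1 - Xᵀ * X)

/-- The componentwise sign of `β - Xᵀ (X β - y)`. -/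
noncomputable def signVector (X : Matrix (Fin n) (Fin p) ℝ) (y : EuclideanSpace ℝ (Fin n))
    (β : EuclideanSpace ℝ (Fin p)) : Fin p → ℝ :=
  fun i => Real.sign (β i - (Xᵀ *ᵥ (X *ᵥ β.ofLp - y.ofLp)) i)

/-- The vectors `-e^lam (Id - diag(q) (Id - Xᵀ X))⁻¹ diag(q) sign(β - Xᵀ (X β - y))`, for `q ∈ M`,
seen as the linear maps `ℝ → ℝᵖ` of which they are the one-column matrices. -/
noncomputable def jacobian (X : Matrix (Fin n) (Fin p) ℝ) (y : EuclideanSpace ℝ (Fin n))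
    (lam : ℝ) (β : EuclideanSpace ℝ (Fin p)) : Set (ℝ →L[ℝ] EuclideanSpace ℝ (Fin p)) :=
  {V | ∃ q ∈ multipliers X y lam β,
    V = ContinuousLinearMap.toSpanSingleton ℝ (WithLp.toLp 2
      (-Real.exp lam • ((systemMatrix X q)⁻¹ *ᵥ (diagonal q *ᵥ signVector X y β))))}

end Lasso

/-! Write c = Xᵀ(y - Xβ). Optimality means |c_i| ≤ e^λ, with c_i = e^λ sign β_i on the support.
Adding the variational inequalities at two parameters bounds the squared change of fit by the change
of e^λ times that of ‖β‖₁ (`sq_mulVec_sub_le`). Since X is injective on vectors supported in the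
equicorrelation set E, and E can only shrink locally, this gives uniqueness and a locally Lipschitz
path.

The path is a continuous selection of finitely many smooth functions, one for each E and sign
pattern, so it is differentiable off a countable set. Zeros with nonzero derivative are isolated, so
off a larger countable set N the identities β_i = 0 and c_i = ±e^λ may also be differentiated. The
derivative then solves the linear system attached to every multiplier q: off N, the Jacobian
consists of the derivative alone (`exists_countable_forall_hasDerivAt`).

A curve meets N with nonzero speed only at countably many times; at zero speed both sides of the
chain rule vanish. Closed graph and local boundedness follow from compactness of [0,1]^p and
invertibility of the system matrices. -/

/-! ### Countable exceptional sets and the chain rule on the real line -/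

/-- The zeros of a function of a real variable at which its derivative exists and does not vanish
form a countable set. -/
theorem countable_zeros_of_deriv_ne_zero {F : Type*} [NormedAddCommGroup F] [NormedSpace ℝ F]
    (g : ℝ → F) :
    {x | g x = 0 ∧ DifferentiableAt ℝ g x ∧ deriv g x ≠ 0}.Countable := by
  -- Each such point is isolated in the set, and a discrete Lindelöf space is countable.
  refine (HereditarilyLindelofSpace.isLindelof _).countable ?_
  rw [discreteTopology_subtype_iff]
  rintro x ⟨-, hd, hne⟩
  have h := hd.hasDerivAt.eventually_ne (c := 0) hne
  rw [← _root_.disjoint_iff, Filter.disjoint_principal_right]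
  filter_upwards [h] with z hz hz'
  exact hz hz'.1

/-- A continuous selection of finitely many differentiable functions of a real variable is
differentiable outside a countable set. -/
theorem countable_not_differentiableAt_of_selection {F ι : Type*} [NormedAddCommGroup F]
    [NormedSpace ℝ F] [Finite ι] {f : ℝ → F} (g : ι → ℝ → F) (hf : Continuous f)
    (hg : ∀ i, Differentiable ℝ (g i)) (hfg : ∀ x, ∃ i, f x = g i x) :
    {x | ¬ DifferentiableAt ℝ f x}.Countable := by
  refine (countable_iUnion fun i => countable_iUnion fun j =>
    countable_zeros_of_deriv_ne_zero (fun x => g i x - g j x)).mono fun x hx => ?_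
  by_contra hN
  simp only [mem_iUnion, mem_ofPred_eq, not_exists, not_and, not_not] at hN
  obtain ⟨i₀, hi₀⟩ := hfg x
  refine hx (HasDerivAt.differentiableAt (f' := deriv (g i₀) x) ?_)
  -- Off the exceptional set, all pieces that meet `f` at `x` share one derivative there.
  have hder : ∀ j, f x = g j x → HasDerivAt (g j) (deriv (g i₀) x) x := by
    intro j hj
    have h := hN i₀ j (by rw [← hi₀, ← hj, sub_self]) ((hg i₀ x).sub (hg j x))
    rw [deriv_fun_sub (hg i₀ x) (hg j x), sub_eq_zero] at h
    rw [h]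
    exact (hg j x).hasDerivAt
  rw [hasDerivAt_iff_isLittleO, Asymptotics.isLittleO_iff]
  intro c hc
  -- Pieces that miss `f` at `x` are not selected nearby, by continuity; the others have the same
  -- first-order expansion.
  have hall : ∀ j, ∀ᶠ z in 𝓝 x, f z = g j z →
      ‖f z - f x - (z - x) • deriv (g i₀) x‖ ≤ c * ‖z - x‖ := by
    intro j
    by_cases hj : f x = g j x
    · filter_upwards [(Asymptotics.isLittleO_iff.1
        (hasDerivAt_iff_isLittleO.1 (hder j hj))) hc] with z hz hfz
      rwa [hfz, hj]
    · filter_upwards [(isOpen_ne_fun hf (hg j).continuous).mem_nhds hj]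
        with z hz hfz
      exact absurd hfz hz
  filter_upwards [eventually_all.2 hall] with z hz
  obtain ⟨j, hj⟩ := hfg z
  exact hz j hj

/-- A locally Lipschitz function of a real variable is constant to first order along a curve at
the points where the derivative of the curve vanishes. -/
theorem LocallyLipschitz.hasDerivAt_comp_of_deriv_zero {F : Type*} [NormedAddCommGroup F]
    [NormedSpace ℝ F] {f : ℝ → F} (hf : LocallyLipschitz f) {γ : ℝ → ℝ} {t : ℝ}
    (hγ : HasDerivAt γ 0 t) : HasDerivAt (fun s => f (γ s)) 0 t := by
  obtain ⟨K, U, hU, hK⟩ := hf (γ t)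
  rw [hasDerivAt_iff_isLittleO] at hγ ⊢
  simp only [smul_zero, sub_zero] at hγ ⊢
  have hc : ContinuousAt γ t := by
    have : HasDerivAt γ 0 t := by
      rw [hasDerivAt_iff_isLittleO]; simpa using hγ
    exact this.continuousAt
  refine Asymptotics.IsBigO.trans_isLittleO (g := fun s => γ s - γ t) ?_ hγ
  refine Asymptotics.IsBigO.of_bound K ?_
  filter_upwards [hc.preimage_mem_nhds hU] with s hs
  simpa [dist_eq_norm] using hK.dist_le_mul _ hs _ (mem_of_mem_nhds hU)

/-- If a locally Lipschitz function of a real variable is differentiable outside a countable set,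
with derivative the only element of `J`, then `J` satisfies the chain rule along curves that are
differentiable almost everywhere. -/
theorem LocallyLipschitz.ae_hasDerivAt_comp {F : Type*} [NormedAddCommGroup F] [NormedSpace ℝ F]
    {f : ℝ → F} (hf : LocallyLipschitz f) {J : ℝ → Set (ℝ →L[ℝ] F)} {N : Set ℝ}
    (hN : N.Countable) (hJ : ∀ x ∉ N, ∀ V ∈ J x, HasDerivAt f (V 1) x) {γ : ℝ → ℝ}
    (hγ : ∀ᵐ t : ℝ, DifferentiableAt ℝ γ t) :
    ∀ᵐ t : ℝ, ∀ V ∈ J (γ t), HasDerivAt (fun s => f (γ s)) (V (deriv γ t)) t := by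
  have hcount : (⋃ x ∈ N, {t | γ t - x = 0 ∧ DifferentiableAt ℝ (fun s => γ s - x) t ∧
      deriv (fun s => γ s - x) t ≠ 0}).Countable :=
    hN.biUnion fun x _ => countable_zeros_of_deriv_ne_zero _
  filter_upwards [hγ, compl_mem_ae_iff.2 (hcount.measure_zero volume)] with t ht htN V hV
  by_cases h0 : deriv γ t = 0
  · rw [h0, map_zero]
    exact hf.hasDerivAt_comp_of_deriv_zero (h0 ▸ ht.hasDerivAt)
  · have hx : γ t ∉ N := by
      intro hx
      refine htN (mem_biUnion hx ⟨sub_self _, ht.sub_const _, ?_⟩)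
      rwa [deriv_sub_const]
    have h := (hJ _ hx V hV).scomp t ht.hasDerivAt
    rw [← map_smul, smul_eq_mul, mul_one] at h
    exact h

/-! ### Optimality conditions and existence -/

namespace Lasso

variable {n p : ℕ}

/-- The vector `Xᵀ (y - X β)` of the correlations of the columns with the residual. -/
def correlation (X : Matrix (Fin n) (Fin p) ℝ) (y : EuclideanSpace ℝ (Fin n))
    (β : EuclideanSpace ℝ (Fin p)) : Fin p → ℝ :=
  Xᵀ *ᵥ (residual X y β).ofLp

variable {X : Matrix (Fin n) (Fin p) ℝ} {y : EuclideanSpace ℝ (Fin n)}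

theorem correlation_eq (β : EuclideanSpace ℝ (Fin p)) :
    correlation X y β = Xᵀ *ᵥ y.ofLp - (Xᵀ * X) *ᵥ β.ofLp := by
  simp [correlation, residual, mulVec_sub, mulVec_mulVec]

theorem mem_equicorrelation {lam : ℝ} {β : EuclideanSpace ℝ (Fin p)} {j : Fin p} :
    j ∈ equicorrelation X y lam β ↔ |correlation X y β j| = Real.exp lam := by
  simp [equicorrelation, correlation]

theorem norm_residual_sq (β : EuclideanSpace ℝ (Fin p)) (v : Fin p → ℝ) (τ : ℝ) :
    ‖residual X y (β + τ • WithLp.toLp 2 v)‖ ^ 2 =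
      ‖residual X y β‖ ^ 2 - 2 * τ * (correlation X y β ⬝ᵥ v) +
        τ ^ 2 * ((X *ᵥ v) ⬝ᵥ (X *ᵥ v)) := by
  have h : (residual X y (β + τ • WithLp.toLp 2 v)).ofLp =
      (residual X y β).ofLp - τ • (X *ᵥ v) := by
    simp only [residual, WithLp.ofLp_sub, WithLp.ofLp_add, WithLp.ofLp_smul, mulVec_add,
      mulVec_smul]
    abel
  have hn : ∀ w : EuclideanSpace ℝ (Fin n), ‖w‖ ^ 2 = w.ofLp ⬝ᵥ w.ofLp := by
    intro w
    rw [EuclideanSpace.real_norm_sq_eq]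
    simp [dotProduct, sq]
  have hc : correlation X y β ⬝ᵥ v = (residual X y β).ofLp ⬝ᵥ (X *ᵥ v) := by
    rw [correlation, mulVec_transpose, dotProduct_mulVec]
  rw [hn, hn, h, hc]
  simp only [sub_dotProduct, dotProduct_sub, smul_dotProduct, dotProduct_smul, smul_eq_mul]
  rw [dotProduct_comm (X *ᵥ v) (residual X y β).ofLp]
  ring

/-- The variational inequality satisfied by the Lasso solutions. -/
theorem variational_inequality {lam : ℝ} {β : EuclideanSpace ℝ (Fin p)}
    (hβ : β ∈ solutions X y lam) (b : Fin p → ℝ) :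
    correlation X y β ⬝ᵥ (b - β.ofLp) ≤ Real.exp lam * (∑ i, |b i| - ∑ i, |β i|) := by
  set v := b - β.ofLp with hv
  set A := correlation X y β ⬝ᵥ v
  set B := (X *ᵥ v) ⬝ᵥ (X *ᵥ v)
  set C := Real.exp lam * (∑ i, |b i| - ∑ i, |β i|) with hC
  have hB : 0 ≤ B := by simpa using dotProduct_star_self_nonneg (X *ᵥ v)
  -- Minimality along the segment from `β` to `b`, with convexity of the ℓ¹ norm, divided by τ; the
  -- quadratic remainder disappears as τ → 0.
  have key : ∀ τ : ℝ, 0 < τ → τ ≤ 1 → A ≤ C + τ * B / 2 := by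
    intro τ h0 h1
    have h := hβ (β + τ • WithLp.toLp 2 v)
    simp only [objective, norm_residual_sq] at h
    have hl : ∑ i, |(β + τ • WithLp.toLp 2 v) i| ≤
        (1 - τ) * ∑ i, |β i| + τ * ∑ i, |b i| := by
      rw [Finset.mul_sum, Finset.mul_sum, ← Finset.sum_add_distrib]
      refine Finset.sum_le_sum fun i _ => ?_
      have : (β + τ • WithLp.toLp 2 v) i = (1 - τ) * β i + τ * b i := by
        simp [hv]; ring
      rw [this]
      refine (abs_add_le _ _).trans ?_
      rw [abs_mul, abs_mul, abs_of_nonneg h0.le, abs_of_nonneg (sub_nonneg.2 h1)]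
    have hl' := mul_le_mul_of_nonneg_left hl (Real.exp_pos lam).le
    have : 0 ≤ τ * (C + τ * B / 2 - A) := by
      rw [hC]
      change _ ≤ 1 / 2 * (_ - 2 * τ * A + τ ^ 2 * B) + _ at h
      linarith
    linarith [nonneg_of_mul_nonneg_right this h0]
  have hlim : Tendsto (fun τ : ℝ => C + τ * B / 2) (𝓝[>] 0) (𝓝 C) := by
    have : Continuous fun τ : ℝ => C + τ * B / 2 := by fun_prop
    simpa using (this.tendsto 0).mono_left nhdsWithin_le_nhds
  refine ge_of_tendsto hlim ?_
  filter_upwards [Ioc_mem_nhdsGT (zero_lt_one' ℝ)] with τ hτ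
  exact key τ hτ.1 hτ.2

theorem sum_abs_update (β : Fin p → ℝ) (i : Fin p) (a : ℝ) :
    ∑ j, |Function.update β i a j| - ∑ j, |β j| = |a| - |β i| := by
  rw [← Finset.sum_sub_distrib, Finset.sum_eq_single i]
  · simp
  · intro j _ hj
    simp [hj]
  · simp

theorem correlation_mul_le {lam : ℝ} {β : EuclideanSpace ℝ (Fin p)}
    (hβ : β ∈ solutions X y lam) (i : Fin p) (a : ℝ) :
    correlation X y β i * (a - β i) ≤ Real.exp lam * (|a| - |β i|) := by
  have h := variational_inequality hβ (Function.update β.ofLp i a)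
  rw [sum_abs_update] at h
  have h2 : Function.update β.ofLp i a - β.ofLp = Pi.single i (a - β i) := by
    ext j
    rcases eq_or_ne j i with rfl | hj
    · simp
    · simp [hj]
  rwa [h2, dotProduct_single] at h

theorem abs_correlation_le {lam : ℝ} {β : EuclideanSpace ℝ (Fin p)}
    (hβ : β ∈ solutions X y lam) (i : Fin p) :
    |correlation X y β i| ≤ Real.exp lam := by
  have hle : ∀ a : ℝ, |β i + a| - |β i| ≤ |a| := fun a => by
    linarith [abs_add_le (β i) a]
  have h1 := correlation_mul_le hβ i (β i + 1)
  have h2 := correlation_mul_le hβ i (β i + -1)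
  have h1' := mul_le_mul_of_nonneg_left (hle 1) (Real.exp_pos lam).le
  have h2' := mul_le_mul_of_nonneg_left (hle (-1)) (Real.exp_pos lam).le
  rw [abs_one] at h1'
  rw [abs_neg, abs_one] at h2'
  rw [abs_le]
  constructor <;> linarith

theorem mul_correlation_eq {lam : ℝ} {β : EuclideanSpace ℝ (Fin p)}
    (hβ : β ∈ solutions X y lam) (i : Fin p) :
    β i * correlation X y β i = Real.exp lam * |β i| := by
  refine le_antisymm ?_ ?_
  · refine (le_abs_self _).trans ?_
    rw [abs_mul, mul_comm]
    exact mul_le_mul_of_nonneg_right (abs_correlation_le hβ i) (abs_nonneg _)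
  -- Testing against `a = 0` gives the reverse inequality.
  · have h := correlation_mul_le hβ i 0
    rw [abs_zero] at h
    linarith

theorem mem_equicorrelation_of_ne_zero {lam : ℝ} {β : EuclideanSpace ℝ (Fin p)}
    (hβ : β ∈ solutions X y lam) {i : Fin p} (hi : β i ≠ 0) :
    i ∈ equicorrelation X y lam β := by
  rw [mem_equicorrelation]
  refine mul_left_cancel₀ (abs_pos.2 hi).ne' ?_
  rw [← abs_mul, mul_correlation_eq hβ, abs_mul, abs_abs, abs_of_pos (Real.exp_pos lam), mul_comm]

/-- Monotonicity of the optimality conditions. -/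
theorem sq_mulVec_sub_le {lam lam' : ℝ} {β β' : EuclideanSpace ℝ (Fin p)}
    (hβ : β ∈ solutions X y lam) (hβ' : β' ∈ solutions X y lam') :
    (X *ᵥ (β' - β).ofLp) ⬝ᵥ (X *ᵥ (β' - β).ofLp) ≤
      (Real.exp lam - Real.exp lam') * (∑ i, |β' i| - ∑ i, |β i|) := by
  have h1 := variational_inequality hβ β'.ofLp
  have h2 := variational_inequality hβ' β.ofLp
  have h3 : (X *ᵥ (β' - β).ofLp) ⬝ᵥ (X *ᵥ (β' - β).ofLp) =
      correlation X y β ⬝ᵥ (β'.ofLp - β.ofLp) + correlation X y β' ⬝ᵥ (β.ofLp - β'.ofLp) := by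
    rw [← neg_sub β'.ofLp β.ofLp, dotProduct_neg, ← sub_eq_add_neg, ← sub_dotProduct,
      correlation_eq, correlation_eq, sub_sub_sub_cancel_left, ← mulVec_sub, ← mulVec_mulVec,
      mulVec_transpose, ← dotProduct_mulVec, WithLp.ofLp_sub]
  rw [h3]
  linarith

theorem exp_mul_sum_abs_le {lam : ℝ} {β : EuclideanSpace ℝ (Fin p)}
    (hβ : β ∈ solutions X y lam) : Real.exp lam * ∑ i, |β i| ≤ ‖y‖ ^ 2 / 2 := by
  have h := hβ 0
  simp only [objective, residual, WithLp.ofLp_zero, mulVec_zero, WithLp.toLp_zero, sub_zero,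
    PiLp.zero_apply, abs_zero, Finset.sum_const_zero, mul_zero, add_zero] at h
  nlinarith [sq_nonneg ‖y - WithLp.toLp 2 (X *ᵥ β.ofLp)‖]

theorem norm_le_sum_abs (β : EuclideanSpace ℝ (Fin p)) : ‖β‖ ≤ ∑ i, |β i| := by
  rw [← abs_of_nonneg (norm_nonneg β),
    ← abs_of_nonneg (Finset.sum_nonneg fun i (_ : i ∈ Finset.univ) => abs_nonneg (β i)),
    ← sq_le_sq, EuclideanSpace.real_norm_sq_eq]
  simp_rw [← sq_abs (β _)]
  exact Finset.sum_sq_le_sq_sum_of_nonneg fun i _ => abs_nonneg _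

theorem continuous_objective (lam : ℝ) : Continuous (objective X y lam) := by
  unfold objective residual
  fun_prop

theorem solutions_nonempty (X : Matrix (Fin n) (Fin p) ℝ) (y : EuclideanSpace ℝ (Fin n))
    (lam : ℝ) : (solutions X y lam).Nonempty := by
  refine (continuous_objective lam).exists_forall_le ?_
  refine tendsto_atTop_mono (f := fun β => Real.exp lam * ‖β‖) (fun β => ?_)
    ((tendsto_norm_cocompact_atTop).const_mul_atTop (Real.exp_pos lam))
  have := mul_le_mul_of_nonneg_left (norm_le_sum_abs β) (Real.exp_pos lam).le
  unfold objective
  nlinarith [sq_nonneg ‖residual X y β‖]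

end Lasso

/-! ### Injectivity on the equicorrelation set and uniqueness -/

namespace Lasso

variable {n p : ℕ} {X : Matrix (Fin n) (Fin p) ℝ} {y : EuclideanSpace ℝ (Fin n)}

theorem eq_zero_of_dotProduct_self_nonpos {m : ℕ} {v : Fin m → ℝ} (h : v ⬝ᵥ v ≤ 0) : v = 0 := by
  have h0 : 0 ≤ v ⬝ᵥ v := by simpa using dotProduct_star_self_nonneg v
  exact dotProduct_self_eq_zero.1 (le_antisymm h h0)

/-- If the Gram matrix of the columns in `E` is invertible, then `X` is injective on the vectors
supported in `E`. -/
theorem eq_zero_of_mulVec_eq_zero {E : Finset (Fin p)}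
    (hE : IsUnit ((columns X E)ᵀ * columns X E)) {v : Fin p → ℝ} (hv : ∀ i, i ∉ E → v i = 0)
    (hXv : X *ᵥ v = 0) : v = 0 := by
  have h1 : columns X E *ᵥ (fun j : E => v j) = X *ᵥ v := by
    ext k
    simp only [mulVec, dotProduct, columns, submatrix_apply, id]
    rw [Finset.sum_coe_sort E fun j => X k j * v j]
    exact Finset.sum_subset (Finset.subset_univ _) fun j _ hj => by rw [hv j hj, mul_zero]
  have h2 : (fun j : E => v j) = 0 := by
    refine mulVec_injective_iff_isUnit.2 hE ?_
    rw [mulVec_zero, ← mulVec_mulVec, h1, hXv, mulVec_zero]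
  ext i
  by_cases hi : i ∈ E
  · exact congrFun h2 ⟨i, hi⟩
  · exact hv i hi

/-- An injective linear map on a finite-dimensional space is antilipschitz, here with constant `K`
for sup norms; passing to the ℓ¹ norm costs a factor `p`. -/
theorem exists_sq_sum_abs_le {E : Finset (Fin p)}
    (hE : IsUnit ((columns X E)ᵀ * columns X E)) :
    ∃ C : ℝ, 0 ≤ C ∧ ∀ v : Fin p → ℝ, (∀ i, i ∉ E → v i = 0) →
      (∑ i, |v i|) ^ 2 ≤ C * ((X *ᵥ v) ⬝ᵥ (X *ᵥ v)) := by
  let S : Submodule ℝ (Fin p → ℝ) :=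
    { carrier := {v | ∀ i, i ∉ E → v i = 0}
      add_mem' := fun {a b} ha hb i hi => by simp [ha i hi, hb i hi]
      zero_mem' := fun i _ => rfl
      smul_mem' := fun r a ha i hi => by simp [ha i hi] }
  let f : S →ₗ[ℝ] (Fin n → ℝ) := (mulVecLin X).domRestrict S
  have hker : LinearMap.ker f = ⊥ := by
    rw [LinearMap.ker_eq_bot']
    intro v hv
    exact Subtype.ext (eq_zero_of_mulVec_eq_zero hE v.2 hv)
  obtain ⟨K, -, hK⟩ := f.exists_antilipschitzWith hker
  refine ⟨(p * K) ^ 2, by positivity, fun v hv => ?_⟩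
  have h1 : ‖v‖ ≤ K * ‖X *ᵥ v‖ := by
    simpa [f] using hK.le_mul_dist (⟨v, hv⟩ : S) 0
  have h2 : ∑ i, |v i| ≤ p * ‖v‖ := by
    refine (Finset.sum_le_card_nsmul _ _ ‖v‖ fun i _ => norm_le_pi_norm v i).trans ?_
    simp
  have h3 : ‖X *ᵥ v‖ ^ 2 ≤ (X *ᵥ v) ⬝ᵥ (X *ᵥ v) := by
    set w := X *ᵥ v
    have hw : 0 ≤ w ⬝ᵥ w := by simpa using dotProduct_star_self_nonneg w
    rw [← Real.le_sqrt (norm_nonneg _) hw, pi_norm_le_iff_of_nonneg (Real.sqrt_nonneg _)]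
    intro k
    refine Real.le_sqrt_of_sq_le ?_
    rw [Real.norm_eq_abs, sq_abs, sq]
    exact Finset.single_le_sum (f := fun k => w k * w k) (fun k _ => mul_self_nonneg _)
      (Finset.mem_univ k)
  calc (∑ i, |v i|) ^ 2 ≤ (p * (K * ‖X *ᵥ v‖)) ^ 2 := by gcongr; exact h2.trans (by gcongr)
    _ = (p * K) ^ 2 * ‖X *ᵥ v‖ ^ 2 := by ring
    _ ≤ _ := by gcongr

/-- At equal parameters the monotonicity bound is 0, so two solutions have the same fit, hence the
same correlations and the same E. Their difference is supported in E and killed by X. -/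
theorem solutions_subsingleton {lam : ℝ}
    (hX : ∀ β ∈ solutions X y lam, IsUnit ((columns X (equicorrelation X y lam β))ᵀ *
        columns X (equicorrelation X y lam β))) :
    (solutions X y lam).Subsingleton := by
  intro β hβ β' hβ'
  have h0 : X *ᵥ (β' - β).ofLp = 0 := by
    refine eq_zero_of_dotProduct_self_nonpos ?_
    simpa using sq_mulVec_sub_le hβ hβ'
  have hc : correlation X y β' = correlation X y β := by
    rw [correlation_eq, correlation_eq, ← sub_eq_zero, sub_sub_sub_cancel_left, ← mulVec_sub,
      ← mulVec_mulVec, ← neg_sub β'.ofLp β.ofLp, mulVec_neg, ← WithLp.ofLp_sub, h0, neg_zero,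
      mulVec_zero]
  have hv : (β' - β).ofLp = 0 := by
    refine eq_zero_of_mulVec_eq_zero (hX β hβ) (fun i hi => ?_) h0
    have h1 : β i = 0 := not_not.1 fun h => hi (mem_equicorrelation_of_ne_zero hβ h)
    have h2 : β' i = 0 := not_not.1 fun h => hi (by
      have := mem_equicorrelation_of_ne_zero hβ' h
      rwa [mem_equicorrelation, hc, ← mem_equicorrelation] at this)
    simp [h1, h2]
  refine (sub_eq_zero.1 ?_).symm
  ext i
  exact congrFun hv i

/-! ### Regularity of the solution path -/

section Path

variable {b : ℝ → EuclideanSpace ℝ (Fin p)}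

/-- This holds for any selection of solutions, before any regularity of `b` is known: the
monotonicity bound carries the factor e^λ - e^l, and ‖β‖₁ is at most e^(-λ)‖y‖²/2. -/
theorem continuous_fit (hb : ∀ lam, b lam ∈ solutions X y lam) :
    Continuous fun lam => X *ᵥ (b lam).ofLp := by
  have hbound : ∀ lam, ∑ i, |b lam i| ≤ Real.exp (-lam) * (‖y‖ ^ 2 / 2) := by
    intro lam
    have h := mul_le_mul_of_nonneg_left (exp_mul_sum_abs_le (hb lam)) (Real.exp_pos (-lam)).le
    rwa [← mul_assoc, ← Real.exp_add, neg_add_cancel, Real.exp_zero, one_mul] at h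
  refine continuous_pi fun k => continuous_iff_continuousAt.2 fun lam => ?_
  rw [ContinuousAt, tendsto_iff_dist_tendsto_zero]
  let G : ℝ → ℝ := fun l => √(|Real.exp lam - Real.exp l| *
    ((Real.exp (-l) + Real.exp (-lam)) * (‖y‖ ^ 2 / 2)))
  have hG : Tendsto G (𝓝 lam) (𝓝 0) := by
    have : Continuous G := by fun_prop
    simpa [G] using this.tendsto lam
  refine squeeze_zero (fun _ => dist_nonneg) (fun l => ?_) hG
  refine Real.le_sqrt_of_sq_le ?_
  set w := X *ᵥ (b l - b lam).ofLp with hw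
  have h1 : dist ((X *ᵥ (b l).ofLp) k) ((X *ᵥ (b lam).ofLp) k) ^ 2 ≤ w ⬝ᵥ w := by
    rw [Real.dist_eq, sq_abs, ← Pi.sub_apply, ← mulVec_sub, ← WithLp.ofLp_sub, ← hw, sq]
    exact Finset.single_le_sum (f := fun k => w k * w k) (fun k _ => mul_self_nonneg _)
      (Finset.mem_univ k)
  refine (h1.trans (sq_mulVec_sub_le (hb lam) (hb l))).trans ((le_abs_self _).trans ?_)
  rw [abs_mul]
  gcongr
  have p1 : 0 ≤ ∑ i, |b l i| := Finset.sum_nonneg fun i _ => abs_nonneg _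
  have p2 : 0 ≤ ∑ i, |b lam i| := Finset.sum_nonneg fun i _ => abs_nonneg _
  rw [abs_le]
  constructor <;> linarith [hbound l, hbound lam]

theorem continuous_correlation (hb : ∀ lam, b lam ∈ solutions X y lam) :
    Continuous fun lam => correlation X y (b lam) := by
  have := continuous_fit hb
  unfold correlation residual
  simp only [WithLp.ofLp_sub]
  exact continuous_const.matrix_mulVec (continuous_const.sub this)

theorem eventually_equicorrelation_subset (hb : ∀ lam, b lam ∈ solutions X y lam) (lam : ℝ) :
    ∀ᶠ l in 𝓝 lam, equicorrelation X y l (b l) ⊆ equicorrelation X y lam (b lam) := by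
  have hc := continuous_correlation hb
  have h : ∀ i, ∀ᶠ l in 𝓝 lam, i ∈ equicorrelation X y l (b l) →
      i ∈ equicorrelation X y lam (b lam) := by
    intro i
    by_cases hi : i ∈ equicorrelation X y lam (b lam)
    · exact Eventually.of_forall fun _ _ => hi
    · have ho : IsOpen {l | |correlation X y (b l) i| ≠ Real.exp l} :=
        isOpen_ne_fun (by fun_prop) (by fun_prop)
      filter_upwards [ho.mem_nhds (by rwa [mem_equicorrelation] at hi)] with l hl hil
      exact absurd (mem_equicorrelation.1 hil) hl
  filter_upwards [eventually_all.2 h] with l hl i hi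
  exact hl i hi

/-- Near `lam` all supports lie in the one set E(`lam`), so a single constant serves: s² ≤ C‖XΔ‖² ≤
C|e^l - e^l'| s, where Δ is the difference of two solutions and s its ℓ¹ norm. Then divide by s. -/
theorem locallyLipschitz_path (hb : ∀ lam, b lam ∈ solutions X y lam)
    (hX : ∀ lam, IsUnit ((columns X (equicorrelation X y lam (b lam)))ᵀ *
        columns X (equicorrelation X y lam (b lam)))) : LocallyLipschitz b := by
  intro lam
  obtain ⟨C, hC0, hC⟩ := exists_sq_sum_abs_le (hX lam)
  obtain ⟨K, U, hU, hK⟩ := (Real.contDiff_exp (n := 1)).locallyLipschitz lam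
  refine ⟨C.toNNReal * K, _, inter_mem hU (eventually_equicorrelation_subset hb lam),
    LipschitzOnWith.of_dist_le_mul fun l hl l' hl' => ?_⟩
  have hsupp : ∀ l, equicorrelation X y l (b l) ⊆ equicorrelation X y lam (b lam) →
      ∀ i, i ∉ equicorrelation X y lam (b lam) → b l i = 0 := fun l hl i hi =>
    not_not.1 fun h => hi (hl (mem_equicorrelation_of_ne_zero (hb l) h))
  have h1 := hC (b l - b l').ofLp fun i hi => by
    simp [hsupp l hl.2 i hi, hsupp l' hl'.2 i hi]
  set s := ∑ i, |(b l - b l').ofLp i| with hs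
  have hs0 : 0 ≤ s := Finset.sum_nonneg fun i _ => abs_nonneg _
  have h2 : (X *ᵥ (b l - b l').ofLp) ⬝ᵥ (X *ᵥ (b l - b l').ofLp) ≤
      |Real.exp l - Real.exp l'| * s := by
    refine (sq_mulVec_sub_le (hb l') (hb l)).trans ((le_abs_self _).trans ?_)
    rw [abs_mul, abs_sub_comm]
    gcongr
    rw [← Finset.sum_sub_distrib]
    refine (Finset.abs_sum_le_sum_abs _ _).trans (Finset.sum_le_sum fun i _ => ?_)
    exact abs_abs_sub_abs_le _ _
  have h3 : s ≤ C * |Real.exp l - Real.exp l'| := by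
    rcases hs0.eq_or_lt with h | h
    · rw [← h]; positivity
    · refine le_of_mul_le_mul_right ?_ h
      have := h1.trans (mul_le_mul_of_nonneg_left h2 hC0)
      linarith
  have h4 := hK.dist_le_mul l hl.1 l' hl'.1
  rw [Real.dist_eq] at h4
  calc dist (b l) (b l') ≤ s := by rw [dist_eq_norm]; exact norm_le_sum_abs _
    _ ≤ C * (K * dist l l') := h3.trans (by gcongr)
    _ = _ := by rw [NNReal.coe_mul, Real.coe_toNNReal _ hC0, mul_assoc]

end Path

end Lasso

/-! ### System matrices and the linear system behind the Jacobian -/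

theorem HasDerivAt.euclidean_apply {ι : Type*} [Fintype ι] {f : ℝ → EuclideanSpace ℝ ι}
    {d : EuclideanSpace ℝ ι} {x : ℝ} (h : HasDerivAt f d x) (i : ι) :
    HasDerivAt (fun z => f z i) (d i) x :=
  (EuclideanSpace.proj (𝕜 := ℝ) i).hasFDerivAt.comp_hasDerivAt x h

theorem isClosed_forall {α : Type*} {ι : Sort*} [TopologicalSpace α] {P : ι → α → Prop}
    (h : ∀ i, IsClosed {x | P i x}) : IsClosed {x | ∀ i, P i x} := by
  have : {x | ∀ i, P i x} = ⋂ i, {x | P i x} := by ext; simp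
  rw [this]
  exact isClosed_iInter h

namespace Lasso

variable {n p : ℕ} {X : Matrix (Fin n) (Fin p) ℝ} {y : EuclideanSpace ℝ (Fin n)}

theorem systemMatrix_mulVec (q v : Fin p → ℝ) :
    systemMatrix X q *ᵥ v = v - q * (v - (Xᵀ * X) *ᵥ v) := by
  rw [systemMatrix, sub_mulVec, one_mulVec, ← mulVec_mulVec, sub_mulVec, one_mulVec]
  ext i
  simp [mulVec_diagonal]

/-- A kernel vector satisfies v_i = q_i (v_i - (XᵀXv)_i), so it is supported in E. Multiplying by
v_i gives q_i v_i (XᵀXv)_i = -(1 - q_i) v_i² ≤ 0; summing v_i (XᵀXv)_i yields ‖Xv‖² ≤ 0, hence v =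
0. -/
theorem isUnit_systemMatrix_of_support {E : Finset (Fin p)}
    (hE : IsUnit ((columns X E)ᵀ * columns X E)) {q : Fin p → ℝ} (hq : q ∈ Icc (0 : Fin p → ℝ) 1)
    (hqE : ∀ i, i ∉ E → q i = 0) : IsUnit (systemMatrix X q) := by
  have hinj : ∀ v, systemMatrix X q *ᵥ v = 0 → v = 0 := by
    intro v hv
    rw [systemMatrix_mulVec] at hv
    have hvi : ∀ i, v i = q i * (v i - ((Xᵀ * X) *ᵥ v) i) := fun i =>
      sub_eq_zero.1 (congrFun hv i)
    refine eq_zero_of_mulVec_eq_zero hE (fun i hi => by rw [hvi, hqE i hi, zero_mul]) ?_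
    refine eq_zero_of_dotProduct_self_nonpos ?_
    have h : (X *ᵥ v) ⬝ᵥ (X *ᵥ v) = ∑ i, v i * ((Xᵀ * X) *ᵥ v) i := by
      rw [dotProduct_mulVec, ← mulVec_transpose, mulVec_mulVec, dotProduct_comm]
      rfl
    rw [h]
    refine Finset.sum_nonpos fun i _ => ?_
    rcases (hq.1 i).eq_or_lt with h0 | h0
    · have : v i = 0 := by rw [hvi, ← h0]; simp
      rw [this, zero_mul]
    · refine nonpos_of_mul_nonpos_right (a := q i) ?_ h0
      have h1 : q i * (v i * ((Xᵀ * X) *ᵥ v) i) = -((1 - q i) * (v i) ^ 2) := by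
        linear_combination (v i) * hvi i
      rw [h1]
      exact neg_nonpos.2 (mul_nonneg (sub_nonneg.2 (hq.2 i)) (sq_nonneg _))
  rw [← mulVec_injective_iff_isUnit]
  intro v w hvw
  exact sub_eq_zero.1 (hinj _ (by rw [mulVec_sub, hvw, sub_self]))

/-- The disjunctions display membership as closed conditions, as the closed graph requires. -/
theorem mem_multipliers_iff {lam : ℝ} {β : EuclideanSpace ℝ (Fin p)} {q : Fin p → ℝ} :
    q ∈ multipliers X y lam β ↔ q ∈ Icc (0 : Fin p → ℝ) 1 ∧
      ∀ i, (β i = 0 ∨ q i = 1) ∧ (|correlation X y β i| = Real.exp lam ∨ q i = 0) := by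
  constructor
  · rintro ⟨h1, h2, h3⟩
    have h : ∀ i, q i ∈ Icc (0 : ℝ) 1 := by
      intro i
      by_cases hE : i ∈ equicorrelation X y lam β
      · by_cases h0 : β i = 0
        · exact h3 i hE h0
        · simp [h1 i h0]
      · simp [h2 i hE]
    refine ⟨⟨fun i => (h i).1, fun i => (h i).2⟩, fun i => ⟨?_, ?_⟩⟩
    · exact or_iff_not_imp_left.2 (h1 i)
    · exact or_iff_not_imp_left.2 fun hE => h2 i (by rwa [mem_equicorrelation])
  · rintro ⟨hq, h⟩
    exact ⟨fun i => or_iff_not_imp_left.1 (h i).1,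
      fun i hE => or_iff_not_imp_left.1 (h i).2 (by rwa [mem_equicorrelation] at hE),
      fun i _ _ => ⟨hq.1 i, hq.2 i⟩⟩

theorem isUnit_systemMatrix {lam : ℝ} {β : EuclideanSpace ℝ (Fin p)}
    (hE : IsUnit ((columns X (equicorrelation X y lam β))ᵀ *
      columns X (equicorrelation X y lam β))) {q : Fin p → ℝ}
    (hq : q ∈ multipliers X y lam β) : IsUnit (systemMatrix X q) :=
  isUnit_systemMatrix_of_support hE (mem_multipliers_iff.1 hq).1 hq.2.1

theorem indicator_mem_multipliers {lam : ℝ} {β : EuclideanSpace ℝ (Fin p)}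
    (hβ : β ∈ solutions X y lam) :
    (fun i => if i ∈ equicorrelation X y lam β then (1 : ℝ) else 0) ∈
      multipliers X y lam β := by
  refine ⟨fun i hi => if_pos (mem_equicorrelation_of_ne_zero hβ hi), fun i hi => if_neg hi,
    fun i hi _ => ?_⟩
  simp [hi]

/-- Where q_i ≠ 0, |c_i| = e^λ and β_i is zero or has the sign of c_i; so β_i + c_i has the sign of
c_i, and scaling by e^λ returns c_i. -/
theorem exp_smul_diagonal_signVector {lam : ℝ} {β : EuclideanSpace ℝ (Fin p)}
    (hβ : β ∈ solutions X y lam) {q : Fin p → ℝ} (hq : q ∈ multipliers X y lam β) :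
    Real.exp lam • (diagonal q *ᵥ signVector X y β) = q * correlation X y β := by
  have hu : ∀ i, β i - (Xᵀ *ᵥ (X *ᵥ β.ofLp - y.ofLp)) i = β i + correlation X y β i := by
    intro i
    rw [correlation_eq, mulVec_sub, mulVec_mulVec, Pi.sub_apply, Pi.sub_apply]
    ring
  ext i
  simp only [Pi.smul_apply, mulVec_diagonal, smul_eq_mul, signVector, hu, Pi.mul_apply]
  rcases ((mem_multipliers_iff.1 hq).2 i).2 with h | h
  · have hm := mul_correlation_eq hβ i
    have he := Real.exp_pos lam
    rw [← h] at hm he ⊢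
    have hc0 : correlation X y β i ≠ 0 := abs_pos.1 he
    rcases hc0.lt_or_gt with hc | hc
    · rw [abs_of_neg hc] at hm ⊢
      have : β i ≤ 0 := by
        have : -β i = |β i| := mul_right_cancel₀ hc0 (by linarith)
        linarith [abs_nonneg (β i)]
      rw [Real.sign_of_neg (by linarith)]
      ring
    · rw [abs_of_pos hc] at hm ⊢
      have : 0 ≤ β i := by
        have : β i = |β i| := mul_right_cancel₀ hc0 (by linarith)
        linarith [abs_nonneg (β i)]
      rw [Real.sign_of_pos (by linarith)]
      ring
  · simp [h]

theorem mem_jacobian_iff {lam : ℝ} {β : EuclideanSpace ℝ (Fin p)}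
    (hβ : β ∈ solutions X y lam) {V : ℝ →L[ℝ] EuclideanSpace ℝ (Fin p)} :
    V ∈ jacobian X y lam β ↔ ∃ q ∈ multipliers X y lam β,
      V 1 = WithLp.toLp 2 (-((systemMatrix X q)⁻¹ *ᵥ (q * correlation X y β))) := by
  refine exists_congr fun q => and_congr_right fun hq => ?_
  have h : -Real.exp lam • ((systemMatrix X q)⁻¹ *ᵥ (diagonal q *ᵥ signVector X y β)) =
      -((systemMatrix X q)⁻¹ *ᵥ (q * correlation X y β)) := by
    rw [← exp_smul_diagonal_signVector hβ hq, mulVec_smul, neg_smul]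
  rw [h]
  constructor
  · rintro rfl
    simp
  · intro hV
    ext1
    simp [hV]

theorem mem_jacobian_iff_systemMatrix {lam : ℝ} {β : EuclideanSpace ℝ (Fin p)}
    (hβ : β ∈ solutions X y lam) (hE : IsUnit ((columns X (equicorrelation X y lam β))ᵀ *
      columns X (equicorrelation X y lam β))) {V : ℝ →L[ℝ] EuclideanSpace ℝ (Fin p)} :
    V ∈ jacobian X y lam β ↔ ∃ q ∈ multipliers X y lam β,
      systemMatrix X q *ᵥ (V 1).ofLp = -(q * correlation X y β) := by
  rw [mem_jacobian_iff hβ]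
  refine exists_congr fun q => and_congr_right fun hq => ?_
  have hu := (isUnit_iff_isUnit_det _).1 (isUnit_systemMatrix hE hq)
  constructor
  · intro hV
    rw [hV, mulVec_neg, mulVec_mulVec, mul_nonsing_inv _ hu, one_mulVec]
  · intro hV
    rw [← mulVec_neg, ← hV, mulVec_mulVec, nonsing_inv_mul _ hu, one_mulVec]

/-! ### The conservative Jacobian of the path -/

section Path

variable {b : ℝ → EuclideanSpace ℝ (Fin p)}

/-- The graph is the projection, along the compact cube of the q, of a set given by closed
conditions; the linear system replaces the matrix inverse. -/
theorem isClosed_graph_jacobian (hb : ∀ lam, b lam ∈ solutions X y lam) (hbc : Continuous b)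
    (hX : ∀ lam, IsUnit ((columns X (equicorrelation X y lam (b lam)))ᵀ *
        columns X (equicorrelation X y lam (b lam)))) :
    IsClosed {z : ℝ × (ℝ →L[ℝ] EuclideanSpace ℝ (Fin p)) | z.2 ∈ jacobian X y z.1 (b z.1)} := by
  have hc := continuous_correlation hb
  let T : Set ((ℝ × (ℝ →L[ℝ] EuclideanSpace ℝ (Fin p))) × Icc (0 : Fin p → ℝ) 1) :=
    {w | (∀ i, (b w.1.1 i = 0 ∨ (w.2 : Fin p → ℝ) i = 1) ∧
        (|correlation X y (b w.1.1) i| = Real.exp w.1.1 ∨ (w.2 : Fin p → ℝ) i = 0)) ∧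
      systemMatrix X w.2 *ᵥ (w.1.2 1).ofLp =
        -((w.2 : Fin p → ℝ) * correlation X y (b w.1.1))}
  have hT : IsClosed T := by
    refine IsClosed.and (isClosed_forall fun i => IsClosed.and ?_ ?_) ?_
    · exact (isClosed_eq (f := fun w : (ℝ × (ℝ →L[ℝ] EuclideanSpace ℝ (Fin p))) ×
          Icc (0 : Fin p → ℝ) 1 => b w.1.1 i) (by fun_prop) continuous_const).union
        (isClosed_eq ((continuous_apply i).comp (continuous_subtype_val.comp continuous_snd))
          continuous_const)
    · exact (isClosed_eq (f := fun w : (ℝ × (ℝ →L[ℝ] EuclideanSpace ℝ (Fin p))) ×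
          Icc (0 : Fin p → ℝ) 1 => |correlation X y (b w.1.1) i|)
          (((continuous_apply i).comp hc).abs.comp (continuous_fst.comp continuous_fst))
          (Real.continuous_exp.comp (continuous_fst.comp continuous_fst))).union
        (isClosed_eq ((continuous_apply i).comp (continuous_subtype_val.comp continuous_snd))
          continuous_const)
    · simp only [systemMatrix_mulVec]
      exact isClosed_eq (by fun_prop) ((continuous_subtype_val.comp continuous_snd).mul
        (hc.comp (continuous_fst.comp continuous_fst))).neg
  convert isClosedMap_fst_of_compactSpace T hT
  ext ⟨lam, V⟩
  rw [mem_ofPred_eq, mem_jacobian_iff_systemMatrix (hb lam) (hX lam)]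
  constructor
  · rintro ⟨q, hq, hV⟩
    obtain ⟨h1, h2⟩ := mem_multipliers_iff.1 hq
    exact ⟨((lam, V), ⟨q, h1⟩), ⟨h2, hV⟩, rfl⟩
  · rintro ⟨⟨⟨l, W⟩, q, hq⟩, ⟨h1, h2⟩, h⟩
    obtain ⟨rfl, rfl⟩ := Prod.mk.inj h
    exact ⟨q, mem_multipliers_iff.2 ⟨hq, h1⟩, h2⟩

/-- Since E can only shrink near `lam`, nearby multipliers vanish off E(`lam`). They fill part of a
compact set on which the system matrix stays invertible and the formula is continuous. -/
theorem locallyBounded_jacobian (hb : ∀ lam, b lam ∈ solutions X y lam)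
    (hX : ∀ lam, IsUnit ((columns X (equicorrelation X y lam (b lam)))ᵀ *
        columns X (equicorrelation X y lam (b lam)))) (lam : ℝ) :
    ∃ U ∈ 𝓝 lam, ∃ M : ℝ, 0 < M ∧ ∀ u ∈ U, ∀ V ∈ jacobian X y u (b u), ‖V‖ < M := by
  have hc := continuous_correlation hb
  set E := equicorrelation X y lam (b lam) with hE
  let Q : Set (Fin p → ℝ) := Icc 0 1 ∩ {q | ∀ i, i ∉ E → q i = 0}
  have hQ : IsCompact Q := by
    refine isCompact_Icc.inter_right ?_
    refine isClosed_forall fun i => isClosed_forall fun _ => ?_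
    exact isClosed_eq (by fun_prop) (by fun_prop)
  let F : ℝ × (Fin p → ℝ) → EuclideanSpace ℝ (Fin p) := fun z =>
    WithLp.toLp 2 (-((systemMatrix X z.2)⁻¹ *ᵥ (z.2 * correlation X y (b z.1))))
  have hF : ContinuousOn F (Icc (lam - 1) (lam + 1) ×ˢ Q) := by
    rintro ⟨l, q⟩ ⟨-, hq⟩
    refine ContinuousAt.continuousWithinAt ?_
    have hdet := (isUnit_iff_isUnit_det _).1 (isUnit_systemMatrix_of_support (hX lam) hq.1 hq.2)
    have h1 : ContinuousAt (fun z : ℝ × (Fin p → ℝ) => (systemMatrix X z.2)⁻¹) (l, q) := by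
      refine ContinuousAt.comp (g := Inv.inv) (continuousAt_matrix_inv _ ?_) ?_
      · rw [Ring.inverse_eq_inv']
        exact continuousAt_inv₀ hdet.ne_zero
      · unfold systemMatrix
        exact (by fun_prop : Continuous fun z : ℝ × (Fin p → ℝ) =>
          1 - diagonal z.2 * (1 - Xᵀ * X)).continuousAt
    have h2 : Continuous fun z : ℝ × (Fin p → ℝ) => z.2 * correlation X y (b z.1) :=
      continuous_snd.mul (hc.comp continuous_fst)
    have hcont : Continuous fun A : Matrix (Fin p) (Fin p) ℝ × (Fin p → ℝ) =>
        WithLp.toLp 2 (-(A.1 *ᵥ A.2)) := by fun_prop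
    exact hcont.continuousAt.comp (h1.prodMk h2.continuousAt)
  obtain ⟨M, hM⟩ := (isCompact_Icc.prod hQ).exists_bound_of_continuousOn hF
  refine ⟨_, inter_mem (Icc_mem_nhds (sub_one_lt lam) (lt_add_one lam))
    (eventually_equicorrelation_subset hb lam), |M| + 1, by positivity, fun u hu V hV => ?_⟩
  obtain ⟨q, hq, hVq⟩ := (mem_jacobian_iff (hb u)).1 hV
  have h1 : V = ContinuousLinearMap.toSpanSingleton ℝ (V 1) := by ext1; simp
  have h2 := hM (u, q) ⟨hu.1, (mem_multipliers_iff.1 hq).1, fun i hi => hq.2.1 i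
    fun h => hi (hu.2 h)⟩
  rw [h1, ContinuousLinearMap.norm_toSpanSingleton, hVq]
  linarith [le_abs_self M]

theorem countable_not_differentiableAt_path (hb : ∀ lam, b lam ∈ solutions X y lam)
    (hbc : Continuous b)
    (hX : ∀ lam, IsUnit ((columns X (equicorrelation X y lam (b lam)))ᵀ *
        columns X (equicorrelation X y lam (b lam)))) :
    {lam | ¬ DifferentiableAt ℝ b lam}.Countable := by
  -- The system reads (XᵀXβ)_i = (Xᵀy)_i ∓ e^λ on E and β_i = 0 off E. For pairs with a singular
  -- matrix the inverse is 0, which keeps the piece differentiable.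
  let g : Finset (Fin p) × Finset (Fin p) → ℝ → EuclideanSpace ℝ (Fin p) := fun ES lam =>
    WithLp.toLp 2 ((systemMatrix X fun i => if i ∈ ES.1 then (1 : ℝ) else 0)⁻¹ *ᵥ
      fun i => if i ∈ ES.1 then
        (Xᵀ *ᵥ y.ofLp) i - Real.exp lam * (if i ∈ ES.2 then 1 else -1) else 0)
  refine countable_not_differentiableAt_of_selection g hbc (fun ES => ?_) fun lam => ?_
  · rw [differentiable_euclidean]
    intro i
    simp only [g, mulVec, dotProduct]
    refine Differentiable.fun_sum fun j _ => Differentiable.const_mul ?_ _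
    split_ifs <;> fun_prop
  · refine ⟨(equicorrelation X y lam (b lam),
      Finset.univ.filter fun i => correlation X y (b lam) i = Real.exp lam), ?_⟩
    have hq := indicator_mem_multipliers (hb lam)
    have hu := (isUnit_iff_isUnit_det _).1 (isUnit_systemMatrix (hX lam) hq)
    have h : (systemMatrix X fun i =>
        if i ∈ equicorrelation X y lam (b lam) then (1 : ℝ) else 0) *ᵥ (b lam).ofLp =
        fun i => if i ∈ equicorrelation X y lam (b lam) then
          (Xᵀ *ᵥ y.ofLp) i - Real.exp lam *
            (if i ∈ Finset.univ.filter fun i => correlation X y (b lam) i = Real.exp lam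
              then 1 else -1) else 0 := by
      ext i
      rw [systemMatrix_mulVec]
      have hci := congrFun (correlation_eq (X := X) (y := y) (b lam)) i
      simp only [Pi.sub_apply, Pi.mul_apply, Finset.mem_filter, Finset.mem_univ, true_and] at hci ⊢
      by_cases hi : i ∈ equicorrelation X y lam (b lam)
      · rw [if_pos hi, if_pos hi]
        have habs := mem_equicorrelation.1 hi
        split_ifs with hs
        · linarith
        · rcases abs_eq (Real.exp_pos lam).le |>.1 habs with h' | h'
          · exact absurd h' hs
          · linarith
      · rw [if_neg hi, if_neg hi, zero_mul, sub_zero]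
        exact not_not.1 fun h => hi (mem_equicorrelation_of_ne_zero (hb lam) h)
    simp only [g]
    rw [← h, mulVec_mulVec, nonsing_inv_mul _ hu, one_mulVec]

theorem hasDerivAt_correlation {lam : ℝ} {d : EuclideanSpace ℝ (Fin p)}
    (hd : HasDerivAt b d lam) (i : Fin p) :
    HasDerivAt (fun l => correlation X y (b l) i) (-((Xᵀ * X) *ᵥ d.ofLp) i) lam := by
  simp only [correlation_eq, Pi.sub_apply]
  refine HasDerivAt.const_sub _ ?_
  simp only [mulVec, dotProduct]
  exact HasDerivAt.fun_sum fun j _ => (hd.euclidean_apply j).const_mul _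

theorem exists_countable_forall_hasDerivAt (hb : ∀ lam, b lam ∈ solutions X y lam)
    (hbc : Continuous b)
    (hX : ∀ lam, IsUnit ((columns X (equicorrelation X y lam (b lam)))ᵀ *
        columns X (equicorrelation X y lam (b lam)))) :
    ∃ N : Set ℝ, N.Countable ∧ ∀ lam ∉ N, ∀ V ∈ jacobian X y lam (b lam),
      HasDerivAt b (V 1) lam := by
  let Z : (ℝ → ℝ) → Set ℝ := fun g => {x | g x = 0 ∧ DifferentiableAt ℝ g x ∧ deriv g x ≠ 0}
  refine ⟨{lam | ¬ DifferentiableAt ℝ b lam} ∪ ⋃ i, (Z (fun l => b l i) ∪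
    (Z (fun l => correlation X y (b l) i - Real.exp l) ∪
      Z (fun l => correlation X y (b l) i + Real.exp l))), ?_, ?_⟩
  · exact (countable_not_differentiableAt_path hb hbc hX).union <| countable_iUnion fun i =>
      (countable_zeros_of_deriv_ne_zero _).union
        ((countable_zeros_of_deriv_ne_zero _).union (countable_zeros_of_deriv_ne_zero _))
  · intro lam hlam V hV
    simp only [mem_union, mem_iUnion, not_or, not_exists, mem_ofPred_eq, not_not, Z,
      not_and] at hlam
    obtain ⟨hdiff, hz⟩ := hlam
    have hd := hdiff.hasDerivAt
    set d := deriv b lam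
    obtain ⟨q, hq, hVq⟩ := (mem_jacobian_iff_systemMatrix (hb lam) (hX lam)).1 hV
    have hdq : systemMatrix X q *ᵥ d.ofLp = -(q * correlation X y (b lam)) := by
      rw [systemMatrix_mulVec]
      ext i
      obtain ⟨hz1, hz2, hz3⟩ := hz i
      have h1 := hd.euclidean_apply i
      have hcor := hasDerivAt_correlation (X := X) (y := y) hd i
      have h2 := hcor.fun_sub (Real.hasDerivAt_exp lam)
      have h3 := hcor.fun_add (Real.hasDerivAt_exp lam)
      have hdi : b lam i = 0 → d i = 0 := fun h => by
        rw [← h1.deriv]; exact hz1 h h1.differentiableAt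
      have hi := (mem_multipliers_iff.1 hq).2 i
      simp only [Pi.sub_apply, Pi.mul_apply, Pi.neg_apply]
      rcases hi.2 with hc | h0
      -- One of c_i ∓ e^λ vanishes at `lam`, which is not exceptional, so its derivative vanishes
      -- too: c_i' = ±e^λ = c_i.
      · have hG : -((Xᵀ * X) *ᵥ d.ofLp) i = correlation X y (b lam) i := by
          rcases abs_eq (Real.exp_pos lam).le |>.1 hc with h' | h'
          · have := hz2 (by linarith) h2.differentiableAt
            rw [h2.deriv] at this
            linarith
          · have := hz3 (by linarith) h3.differentiableAt
            rw [h3.deriv] at this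
            linarith
        -- A value q_i ≠ 1 is allowed only where β_i = 0, and there d_i = 0; this is why every q
        -- gives the same solution.
        have hq' : d i = q i * d i := by
          rcases hi.1 with h | h
          · rw [hdi h, mul_zero]
          · rw [h, one_mul]
        rw [← hG]
        linarith
      · have : b lam i = 0 := hi.1.resolve_right (by rw [h0]; exact zero_ne_one)
        rw [h0, hdi this]
        ring
    have hVd : (V 1).ofLp = d.ofLp :=
      mulVec_injective_iff_isUnit.2 (isUnit_systemMatrix (hX lam) hq) (hVq.trans hdq.symm)
    have : V 1 = d := by ext i; exact congrFun hVd i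
    rwa [this]

end Path

end Lasso

theorem proposition5 {n p : ℕ} (X : Matrix (Fin n) (Fin p) ℝ) (y : EuclideanSpace ℝ (Fin n))
    (hX : ∀ lam : ℝ, ∀ β ∈ Lasso.solutions X y lam,
      IsUnit ((Lasso.columns X (Lasso.equicorrelation X y lam β))ᵀ *
        Lasso.columns X (Lasso.equicorrelation X y lam β))) :
    ∃ βhat : ℝ → EuclideanSpace ℝ (Fin p),
      (∀ lam : ℝ, Lasso.solutions X y lam = {βhat lam}) ∧
      PathDifferentiable βhat ∧
      (∀ lam : ℝ, ∀ q ∈ Lasso.multipliers X y lam (βhat lam), IsUnit (Lasso.systemMatrix X q)) ∧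
      IsConservativeJacobian βhat (fun lam => Lasso.jacobian X y lam (βhat lam)) := by
  choose b hb using Lasso.solutions_nonempty X y
  have hXb := fun lam => hX lam (b lam) (hb lam)
  have hlip := Lasso.locallyLipschitz_path hb hXb
  have hJ : IsConservativeJacobian b (fun lam => Lasso.jacobian X y lam (b lam)) :=
    { nonempty := fun lam => ⟨_, _, Lasso.indicator_mem_multipliers (hb lam), rfl⟩
      isClosed_graph := Lasso.isClosed_graph_jacobian hb hlip.continuous hXb
      locally_bounded := Lasso.locallyBounded_jacobian hb hXb
      chain_rule := fun γ hγ => by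
        obtain ⟨N, hN, h⟩ := Lasso.exists_countable_forall_hasDerivAt hb hlip.continuous hXb
        exact hlip.ae_hasDerivAt_comp hN h hγ.ae_differentiableAt }
  exact ⟨b, fun lam => (Lasso.solutions_subsingleton (hX lam)).eq_singleton_of_mem (hb lam),
    ⟨hlip, _, hJ⟩, fun lam q hq => Lasso.isUnit_systemMatrix (hXb lam) hq, hJ⟩
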